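/- **Proposition P2 (general bound, symmetric case).** Let $c>0$, let $A\in\mathbb{R}^{n\times n}$ be symmetric with all eigenvalues in $[0,2c]$, and let $g,v\in\mathbb{R}^n$ be such that $\tilde g:=g-Av$ has $\|\tilde g\|=1$ (Euclidean norm). Consider the initial value problem $y'(t)=-Ay(t)+g$, $y(0)=v$. Let $v_1=\tilde g/\|\tilde g\|,v_2,\dots,v_k$ be the vectors produced by the Arnoldi process, i.e. $h_{j+1,j}v_{j+1}=Av_j-\sum_{i=1}^{j}(v_i^TAv_j)v_i$, where $h_{j+1,j}\ge 0$ is the norm of the right-hand side (if $h_{j+1,j}=0$, put $v_{j+1}=0$); let $V_k=[v_1,\dots,v_k]$ and $H_k=V_k^TAV_k$. Let $\varphi$ be the entire function $\varphi(z)=(e^z-1)/z$, $\varphi(0)=1$, let $$y_k(t)=v+V_k\,t\,\varphi(-tH_k)\,(\|\tilde g\|e_1)$$ be the Krylov subspace approximation to $y(t)$ and $$r_k(t)=-Ay_k(t)+g-y_k'(t)$$ its residual. Then for all $k\ge 2$ and $t\ge 0$ $$\|r_k(t)\|\le 4e^{-ct}\sum_{\nu=k}^{\infty}(\nu-k+2)(\nu-k+1)\,I_\nu(ct),$$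 where $I_\nu(x)=\sum_{m\ge 0}\frac{(x/2)^{2m+\nu}}{m!\,(m+\nu)!}$ are the modified Bessel functions of the first kind; in particular, $y_k$ is differentiable at $t$ and the series on the right converges. -/

import Mathlib

open scoped Nat

noncomputable section

/-- The vectors `v₁, v₂, …` of the Arnoldi process for the matrix `A` and the vector `g`, indexed
from `0`: the first one is `g / ‖g‖`; the next one is obtained by orthogonalizing `A v_j` against
all vectors found so far and dividing the result by its norm `h_{j+1,j}`.  If the process breaks
down, i.e. `h_{j+1,j} = 0`, the next vectors are zero. -/
def arnoldiVec {n : ℕ} (A : Matrix (Fin n) (Fin n) ℝ) (g : EuclideanSpace ℝ (Fin n)) :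
    ℕ → EuclideanSpace ℝ (Fin n)
  | 0 => ‖g‖⁻¹ • g
  | j + 1 =>
    let w : EuclideanSpace ℝ (Fin n) := A.toEuclideanLin (arnoldiVec A g j) -
      ∑ i : Fin (j + 1),
        inner ℝ (arnoldiVec A g i) (A.toEuclideanLin (arnoldiVec A g j)) • arnoldiVec A g i
    ‖w‖⁻¹ • w
termination_by j => j
decreasing_by all_goals omega

/-- The matrix `V_k` whose columns are the first `k` Arnoldi vectors. -/
def arnoldiBasis {n : ℕ} (A : Matrix (Fin n) (Fin n) ℝ) (g : EuclideanSpace ℝ (Fin n)) (k : ℕ) :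
    Matrix (Fin n) (Fin k) ℝ :=
  Matrix.of fun i j => arnoldiVec A g j i

/-- The projected matrix `H_k = V_kᵀ A V_k`. -/
def arnoldiHess {n : ℕ} (A : Matrix (Fin n) (Fin n) ℝ) (g : EuclideanSpace ℝ (Fin n)) (k : ℕ) :
    Matrix (Fin k) (Fin k) ℝ :=
  (arnoldiBasis A g k).transpose * A * arnoldiBasis A g k

/-- The matrix function `φ` for the entire function `φ(z) = (e ^ z - 1) / z`, `φ(0) = 1`, given by
its power series `φ(M) = ∑ M ^ j / (j + 1)!`. -/
def phiMatrix {k : ℕ} (M : Matrix (Fin k) (Fin k) ℝ) : Matrix (Fin k) (Fin k) ℝ :=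
  ∑' j : ℕ, ((j + 1)! : ℝ)⁻¹ • M ^ j

/-- The power series of `φ` converges for every matrix. -/
theorem summable_phiMatrix {k : ℕ} (M : Matrix (Fin k) (Fin k) ℝ) :
    Summable fun j : ℕ => ((j + 1)! : ℝ)⁻¹ • M ^ j := by
  let _ : NormedRing (Matrix (Fin k) (Fin k) ℝ) := Matrix.linftyOpNormedRing
  let _ : NormedAlgebra ℝ (Matrix (Fin k) (Fin k) ℝ) := Matrix.linftyOpNormedAlgebra
  have h := NormedSpace.norm_expSeries_summable' (𝕂 := ℝ) M
  refine Summable.of_norm_bounded h fun j => ?_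
  rw [norm_smul, norm_smul]
  gcongr
  rw [Real.norm_of_nonneg (by positivity), Real.norm_of_nonneg (by positivity)]
  gcongr
  omega

/-- `z φ(z) = e ^ z - 1` for the matrix function `φ`. -/
theorem mul_phiMatrix {k : ℕ} (M : Matrix (Fin k) (Fin k) ℝ) :
    M * phiMatrix M = NormedSpace.exp M - 1 := by
  let _ : NormedRing (Matrix (Fin k) (Fin k) ℝ) := Matrix.linftyOpNormedRing
  let _ : NormedAlgebra ℝ (Matrix (Fin k) (Fin k) ℝ) := Matrix.linftyOpNormedAlgebra
  have h : HasSum (fun j : ℕ => M * ((((j + 1)! : ℕ) : ℝ)⁻¹ • M ^ j)) (M * phiMatrix M) :=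
    (summable_phiMatrix M).hasSum.mul_left M
  have h2 := NormedSpace.exp_series_hasSum_exp' (𝕂 := ℝ) M
  rw [← hasSum_nat_add_iff' 1] at h2
  simp only [Finset.sum_range_one, pow_zero, Nat.factorial_zero, Nat.cast_one, inv_one,
    one_smul] at h2
  refine h.unique ?_
  have h3 : (fun j : ℕ => M * ((((j + 1)! : ℕ) : ℝ)⁻¹ • M ^ j)) =
      fun j : ℕ => (((j + 1)! : ℕ) : ℝ)⁻¹ • M ^ (j + 1) := by
    funext j
    rw [mul_smul_comm, pow_succ']
  rw [h3]
  exact h2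

/-- The vector `u(t) = t φ(-t H_k) (β e₁)`, `β = ‖g‖`, solving the projected problem. -/
def krylovCoeff {n : ℕ} (A : Matrix (Fin n) (Fin n) ℝ) (g : EuclideanSpace ℝ (Fin n)) (k : ℕ)
    (t : ℝ) : Fin k → ℝ :=
  t • (phiMatrix ((-t) • arnoldiHess A g k)).mulVec
    (‖g‖ • fun i : Fin k => if (i : ℕ) = 0 then (1 : ℝ) else 0)

/-- The `k`-step Krylov subspace approximation `y_k(t) = v + V_k u(t)` to the solution of
`y' = -A y + g`, `y(0) = v`.  Here `V_k` and `u` belong to `A` and the vector `g - A v`. -/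
def krylovApprox {n : ℕ} (A : Matrix (Fin n) (Fin n) ℝ) (g v : EuclideanSpace ℝ (Fin n)) (k : ℕ)
    (t : ℝ) : EuclideanSpace ℝ (Fin n) :=
  v + WithLp.toLp 2 ((arnoldiBasis A (g - A.toEuclideanLin v) k).mulVec
    (krylovCoeff A (g - A.toEuclideanLin v) k t))

/-- The residual `r_k(t) = -A y_k(t) + g - y_k'(t)`. -/
def krylovResidual {n : ℕ} (A : Matrix (Fin n) (Fin n) ℝ) (g v : EuclideanSpace ℝ (Fin n)) (k : ℕ)
    (t : ℝ) : EuclideanSpace ℝ (Fin n) :=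
  -A.toEuclideanLin (krylovApprox A g v k t) + g - deriv (krylovApprox A g v k) t

/-- The modified Bessel function of the first kind `I_ν(x)` of integer order `ν ≥ 0`. -/
def besselI (ν : ℕ) (x : ℝ) : ℝ :=
  ∑' m : ℕ, (x / 2) ^ (2 * m + ν) / ((m ! : ℝ) * ((m + ν)! : ℝ))

/-- The power series of `I_ν` converges everywhere. -/
theorem summable_besselI (ν : ℕ) (x : ℝ) :
    Summable fun m : ℕ => (x / 2) ^ (2 * m + ν) / ((m ! : ℝ) * ((m + ν)! : ℝ)) := by
  have h := (Real.summable_pow_div_factorial ((x / 2) ^ 2)).mul_left (|x / 2| ^ ν)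
  refine Summable.of_norm_bounded h fun m => ?_
  have h1 : (1 : ℝ) ≤ ((m + ν)! : ℝ) := by exact_mod_cast Nat.one_le_iff_ne_zero.2 (by positivity)
  rw [norm_div, norm_pow, Real.norm_eq_abs, pow_add, pow_mul, sq_abs,
    Real.norm_of_nonneg (by positivity), mul_comm, mul_div_assoc]
  gcongr
  exact le_mul_of_one_le_right (by positivity) h1

end

/-! Let `w = g - A v`. The residual is `-u(t)_k h_{k+1,k} v_{k+1}`, and
`u'(t) = exp (-t H_k) (‖w‖ e₁)`, so everything rests on the last entry of the first column of
`exp (-t H_k)`. Writing `exp (-t H_k) = e^{-ct} exp (ct M)` with `M = 1 - H_k / c`, expand the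
powers of `M` in Chebyshev polynomials: `X ^ N` is the expectation of `T_{S_N}`, where `S` is the
simple random walk on `ℤ`. The spectrum of `M` lies in `[-1, 1]`, so the entries of `T_n(M)` are at
most `1` in absolute value, and as `H_k` is Hessenberg, the entry in question vanishes for
`|n| < k - 1`. Hence that entry of `M ^ N` is at most `2 P(S_N ≥ k - 1)`.

Integrating in time is avoided by comparing derivatives: the weight `s (s + 1)`, with
`s = n - (k - 1)`, solves the discrete Poisson equation whose right-hand side is the indicator of
`n ≥ k - 1`. Grouping the paths by their endpoint turns the resulting generating function of the
walk into the Bessel series, and `h_{k+1,k} ≤ c` gives the bound.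
-/

section ExponentialSeries

variable {E : Type*} [NormedAddCommGroup E] [NormedSpace ℝ E] [CompleteSpace E]

theorem hasDerivAt_tsum_pow_succ_div_factorial_smul {b : ℕ → E}
    (hb : ∀ R : ℝ, Summable fun N => ‖(R ^ N / N !) • b N‖) (x : ℝ) :
    HasDerivAt (fun y : ℝ => ∑' N, (y ^ (N + 1) / (N + 1)!) • b N)
      (∑' N, (x ^ N / N !) • b N) x := by
  have hderiv : ∀ N, ∀ y ∈ Metric.ball (0 : ℝ) (|x| + 1),
      HasDerivAt (fun y : ℝ => (y ^ (N + 1) / (N + 1)!) • b N) ((y ^ N / N !) • b N) y := by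
    intro N y _
    refine HasDerivAt.smul_const ?_ (b N)
    convert (hasDerivAt_pow (N + 1) y).div_const _ using 1
    rw [Nat.factorial_succ, add_tsub_cancel_right]
    push_cast
    field_simp
  refine hasDerivAt_tsum_of_isPreconnected (hb (|x| + 1)) Metric.isOpen_ball
    (convex_ball _ _).isPreconnected hderiv (fun N y hy => ?_)
    (Metric.mem_ball_self (by positivity)) (by simp [summable_zero]) (by simp)
  rw [norm_smul, norm_smul, norm_div, norm_div, norm_pow, norm_pow]
  gcongr
  rw [mem_ball_zero_iff] at hy
  exact hy.le.trans (le_abs_self _)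

end ExponentialSeries

section RandomWalk

open Finset.HasAntidiagonal

variable {E : Type*}

section Module

variable [AddCommGroup E] [Module ℝ E]

/-- The expectation of `f` at the position, after `N` steps, of the simple random walk on `ℤ`
started at `0`; the summand indexed by `p` collects the paths with `p.1` steps to the left and
`p.2` steps to the right. -/
noncomputable def walkMean (f : ℤ → E) (N : ℕ) : E :=
  ((2 : ℝ) ^ N)⁻¹ • ∑ p ∈ antidiagonal N, N.choose p.1 • f ((p.2 : ℤ) - p.1)

/-- The expectation of `f` after one step of the simple random walk on `ℤ`, as a function of the
starting point. -/
noncomputable def walkStep (f : ℤ → E) (n : ℤ) : E :=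
  (2 : ℝ)⁻¹ • (f (n + 1) + f (n - 1))

theorem walkMean_zero (f : ℤ → E) : walkMean f 0 = f 0 := by
  simp [walkMean]

theorem walkMean_succ (f : ℤ → E) (N : ℕ) : walkMean f (N + 1) = walkMean (walkStep f) N := by
  simp only [walkMean, walkStep, smul_comm _ (2 : ℝ)⁻¹, ← Finset.smul_sum, smul_smul, smul_add,
    Finset.sum_add_distrib]
  rw [← smul_add, ← mul_inv, ← pow_succ',
    Finset.sum_antidiagonal_choose_succ_nsmul (fun i j => f ((j : ℤ) - i))]
  congr 2
  · exact Finset.sum_congr rfl fun p _ => by push_cast; congr 2; ring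
  · refine Finset.sum_congr rfl fun p hp => ?_
    rw [Nat.choose_symm_of_eq_add (mem_antidiagonal.1 hp).symm]
    push_cast
    congr 2
    ring

theorem walkMean_add (f g : ℤ → E) (N : ℕ) :
    walkMean (f + g) N = walkMean f N + walkMean g N := by
  simp only [walkMean, Pi.add_apply, smul_add, Finset.sum_add_distrib]

theorem map_walkMean {F : Type*} [AddCommGroup F] [Module ℝ F] (L : E →ₗ[ℝ] F) (f : ℤ → E)
    (N : ℕ) : L (walkMean f N) = walkMean (fun n => L (f n)) N := by
  simp only [walkMean, map_smul, map_sum, map_nsmul]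

theorem walkMean_comp_neg (f : ℤ → E) (N : ℕ) :
    walkMean (fun n => f (-n)) N = walkMean f N := by
  rw [walkMean, walkMean, ← Finset.Nat.sum_antidiagonal_swap]
  congr 1
  refine Finset.sum_congr rfl fun p hp => ?_
  rw [Prod.fst_swap, Prod.snd_swap, neg_sub,
    Nat.choose_symm_of_eq_add (mem_antidiagonal.1 hp).symm]

end Module

theorem walkMean_mono {f g : ℤ → ℝ} (h : f ≤ g) (N : ℕ) : walkMean f N ≤ walkMean g N := by
  unfold walkMean
  gcongr
  exact h _

section Norm

variable [NormedAddCommGroup E] [NormedSpace ℝ E]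

theorem norm_walkMean_le (f : ℤ → E) (N : ℕ) :
    ‖walkMean f N‖ ≤ walkMean (fun n => ‖f n‖) N := by
  rw [walkMean, norm_smul, norm_inv, norm_pow, Real.norm_two, walkMean, smul_eq_mul]
  gcongr
  refine (norm_sum_le _ _).trans (Finset.sum_le_sum fun p _ => ?_)
  simpa using norm_nsmul_le (n := N.choose p.1) (a := f (p.2 - p.1))

theorem norm_walkStep_le {f : ℤ → E} {C r : ℝ} (hr : 1 ≤ r)
    (hf : ∀ n, ‖f n‖ ≤ C * r ^ n.natAbs) (n : ℤ) : ‖walkStep f n‖ ≤ C * r * r ^ n.natAbs := by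
  have hC : 0 ≤ C := by simpa using (norm_nonneg _).trans (hf 0)
  have hneighbour : ∀ m : ℤ, m.natAbs ≤ n.natAbs + 1 → ‖f m‖ ≤ C * r * r ^ n.natAbs := by
    intro m hm
    calc ‖f m‖ ≤ C * r ^ m.natAbs := hf m
      _ ≤ C * r ^ (n.natAbs + 1) := by gcongr
      _ = C * r * r ^ n.natAbs := by ring
  rw [walkStep, norm_smul, norm_inv, Real.norm_two]
  linarith [norm_add_le (f (n + 1)) (f (n - 1)), hneighbour (n + 1) (by omega),
    hneighbour (n - 1) (by omega)]

theorem norm_walkMean_le_mul_pow {f : ℤ → E} {C r : ℝ} (hr : 1 ≤ r)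
    (hf : ∀ n, ‖f n‖ ≤ C * r ^ n.natAbs) (N : ℕ) : ‖walkMean f N‖ ≤ C * r ^ N := by
  induction N generalizing f C with
  | zero => simpa [walkMean_zero] using hf 0
  | succ N ih =>
    rw [walkMean_succ, pow_succ', ← mul_assoc]
    exact ih (norm_walkStep_le hr hf)

end Norm

end RandomWalk

section Chebyshev

open Polynomial

theorem walkStep_chebyshev (R : Type*) [CommRing R] [Algebra ℝ R] :
    walkStep (Chebyshev.T R) = fun n => X * Chebyshev.T R n := by
  funext n
  rw [walkStep, Chebyshev.T_add_one, sub_add_cancel, inv_smul_eq_iff₀ two_ne_zero,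
    two_smul]
  ring

theorem walkMean_chebyshev (R : Type*) [CommRing R] [Algebra ℝ R] (N : ℕ) :
    walkMean (Chebyshev.T R) N = X ^ N := by
  induction N with
  | zero => rw [walkMean_zero, Chebyshev.T_zero, pow_zero]
  | succ N ih =>
    rw [walkMean_succ, walkStep_chebyshev, pow_succ', ← ih]
    exact (map_walkMean (LinearMap.mulLeft ℝ (X : R[X])) (Chebyshev.T R) N).symm

/-- The indicator function of the half-line `{n | a ≤ n}` in `ℤ`, the payoff whose expectation is
the tail probability of the random walk. -/
noncomputable def tailIndicator (a n : ℤ) : ℝ :=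
  if a ≤ n then 1 else 0

theorem tailIndicator_nonneg (a n : ℤ) : 0 ≤ tailIndicator a n := by
  unfold tailIndicator
  split_ifs <;> norm_num

theorem norm_map_X_pow_le_two_mul_walkMean {E : Type*} [NormedAddCommGroup E] [NormedSpace ℝ E]
    {L : ℝ[X] →ₗ[ℝ] E} {a : ℕ} (hL : ∀ n : ℤ, ‖L (Chebyshev.T ℝ n)‖ ≤ 1)
    (hLa : ∀ p : ℝ[X], p.natDegree < a → L p = 0) (N : ℕ) :
    ‖L (X ^ N)‖ ≤ 2 * walkMean (tailIndicator a) N := by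
  have hbound (n : ℤ) :
      ‖L (Chebyshev.T ℝ n)‖ ≤ tailIndicator a n + tailIndicator a (-n) := by
    rcases lt_or_ge n.natAbs a with hn | hn
    · rw [hLa _ (by rwa [Chebyshev.natDegree_T]), norm_zero]
      exact add_nonneg (tailIndicator_nonneg _ _) (tailIndicator_nonneg _ _)
    · refine (hL n).trans ?_
      unfold tailIndicator
      rcases Int.natAbs_eq n with h | h
      · rw [if_pos (by omega)]; split_ifs <;> norm_num
      · rw [if_pos (by omega : (a : ℤ) ≤ -n)]; split_ifs <;> norm_num
  calc ‖L (X ^ N)‖ = ‖walkMean (fun n => L (Chebyshev.T ℝ n)) N‖ := by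
        rw [← walkMean_chebyshev, map_walkMean]
    _ ≤ walkMean (fun n => ‖L (Chebyshev.T ℝ n)‖) N := norm_walkMean_le _ N
    _ ≤ walkMean (tailIndicator a + fun n => tailIndicator a (-n)) N := walkMean_mono hbound N
    _ = 2 * walkMean (tailIndicator a) N := by rw [walkMean_add, walkMean_comp_neg, two_mul]

end Chebyshev

section WalkGenFun

/-- The exponential generating function `∑ x ^ N / N! * E[f(S_N)]` of the expectations of `f` along
the simple random walk on `ℤ`. For `x ≥ 0`, `exp (-x) * walkGenFun f x` is the expectation of `f` at
the position at time `x` of the walk jumping at the times of a Poisson process of rate one. -/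
noncomputable def walkGenFun (f : ℤ → ℝ) (x : ℝ) : ℝ :=
  ∑' N, x ^ N / N ! * walkMean f N

theorem walkGenFun_zero (f : ℤ → ℝ) : walkGenFun f 0 = f 0 := by
  rw [walkGenFun, tsum_eq_single 0 fun N hN => by rw [zero_pow hN, zero_div, zero_mul]]
  simp [walkMean_zero]

variable {f g : ℤ → ℝ} {C D r : ℝ}

theorem summable_norm_walkGenFun (hr : 1 ≤ r) (hf : ∀ n, ‖f n‖ ≤ C * r ^ n.natAbs) (x : ℝ) :
    Summable fun N => ‖x ^ N / N ! * walkMean f N‖ := by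
  refine .of_nonneg_of_le (fun N => norm_nonneg _) (fun N => ?_)
    ((Real.summable_pow_div_factorial (|x| * r)).mul_left C)
  calc ‖x ^ N / N ! * walkMean f N‖ = |x| ^ N / N ! * ‖walkMean f N‖ := by
        rw [norm_mul, norm_div, norm_pow, Real.norm_natCast, Real.norm_eq_abs]
    _ ≤ |x| ^ N / N ! * (C * r ^ N) := by gcongr; exact norm_walkMean_le_mul_pow hr hf N
    _ = C * ((|x| * r) ^ N / N !) := by rw [mul_pow]; ring

theorem walkGenFun_add (hr : 1 ≤ r) (hf : ∀ n, ‖f n‖ ≤ C * r ^ n.natAbs)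
    (hg : ∀ n, ‖g n‖ ≤ D * r ^ n.natAbs) (x : ℝ) :
    walkGenFun (f + g) x = walkGenFun f x + walkGenFun g x := by
  simp only [walkGenFun, walkMean_add, mul_add]
  exact (summable_norm_walkGenFun hr hf x).of_norm.tsum_add
    (summable_norm_walkGenFun hr hg x).of_norm

theorem hasDerivAt_walkGenFun (hr : 1 ≤ r) (hf : ∀ n, ‖f n‖ ≤ C * r ^ n.natAbs) (x : ℝ) :
    HasDerivAt (walkGenFun f) (walkGenFun (walkStep f) x) x := by
  have hexpand : walkGenFun f =
      fun y : ℝ => f 0 + ∑' N, (y ^ (N + 1) / (N + 1)!) • walkMean (walkStep f) N := by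
    funext y
    rw [walkGenFun, (summable_norm_walkGenFun hr hf y).of_norm.tsum_eq_zero_add]
    simp [walkMean_zero, walkMean_succ]
  rw [hexpand]
  exact (hasDerivAt_tsum_pow_succ_div_factorial_smul
    (summable_norm_walkGenFun hr (norm_walkStep_le hr hf)) x).const_add _

/-- The function `s (s + 1)` of `s = n - a` on the half-line `a ≤ n`, extended by zero: the
solution of the discrete Poisson equation `walkStep w - w = tailIndicator a`. -/
noncomputable def tailWeight (a n : ℤ) : ℝ :=
  if a ≤ n then ((n : ℝ) - a) * ((n : ℝ) - a + 1) else 0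

theorem tailWeight_zero (a : ℕ) : tailWeight a 0 = 0 := by
  unfold tailWeight
  split_ifs with h
  · simp [Nat.cast_nonpos.1 h]
  · rfl

theorem walkStep_tailWeight (a : ℤ) : walkStep (tailWeight a) = tailWeight a + tailIndicator a := by
  funext n
  simp only [walkStep, Pi.add_apply, tailWeight, tailIndicator, smul_eq_mul]
  rcases lt_trichotomy (n + 1) a with h | rfl | h
  · rw [if_neg (by omega), if_neg (by omega), if_neg (by omega), if_neg (by omega)]
    norm_num
  · rw [if_pos le_rfl, if_neg (by omega), if_neg (by omega), if_neg (by omega)]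
    norm_num
  · rcases (Int.lt_add_one_iff.1 h).eq_or_lt with rfl | h
    · norm_num
    · rw [if_pos (by omega), if_pos (by omega), if_pos h.le, if_pos h.le]
      push_cast
      ring

theorem norm_tailIndicator_le (a n : ℤ) : ‖tailIndicator a n‖ ≤ 1 * 2 ^ n.natAbs := by
  rw [Real.norm_of_nonneg (tailIndicator_nonneg a n), one_mul]
  refine le_trans ?_ (one_le_pow₀ one_le_two)
  unfold tailIndicator
  split_ifs <;> norm_num

theorem norm_tailWeight_le (a : ℕ) (n : ℤ) : ‖tailWeight a n‖ ≤ 4 * 2 ^ n.natAbs := by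
  unfold tailWeight
  split_ifs with h
  · obtain ⟨s, rfl⟩ := Int.le.dest h
    have hchoose : ((s + 1 : ℕ) * ((s + 1 : ℕ) - 1) / 2 : ℝ) ≤ 2 ^ (s + 1) := by
      rw [← Nat.cast_choose_two]
      exact_mod_cast Nat.choose_le_two_pow (s + 1) 2
    calc ‖(((a + s : ℤ) : ℝ) - (a : ℤ)) * (((a + s : ℤ) : ℝ) - (a : ℤ) + 1)‖ = s * (s + 1) := by
          push_cast
          rw [add_sub_cancel_left, Real.norm_of_nonneg (by positivity)]
      _ ≤ 4 * 2 ^ s := by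
          push_cast [pow_succ] at hchoose
          linarith
      _ ≤ 4 * 2 ^ (a + s : ℤ).natAbs := by
          gcongr
          · exact one_le_two
          · omega
  · simp

theorem hasDerivAt_exp_neg_mul_walkGenFun_tailWeight (a : ℕ) (x : ℝ) :
    HasDerivAt (fun x => Real.exp (-x) * walkGenFun (tailWeight a) x)
      (Real.exp (-x) * walkGenFun (tailIndicator a) x) x := by
  have hderiv := (hasDerivAt_neg x).exp.mul
    (hasDerivAt_walkGenFun one_le_two (norm_tailWeight_le a) x)
  rw [walkStep_tailWeight, walkGenFun_add one_le_two (norm_tailWeight_le a)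
    (norm_tailIndicator_le a)] at hderiv
  exact hderiv.congr_deriv (by ring)

end WalkGenFun

section Bessel

open Finset.HasAntidiagonal

/-- The parametrization of the pairs of natural numbers by their difference and their minimum. -/
def differenceMinEquiv : ℤ × ℕ ≃ ℕ × ℕ where
  toFun q := (q.2 + (-q.1).toNat, q.2 + q.1.toNat)
  invFun p := ((p.2 : ℤ) - p.1, min p.1 p.2)
  left_inv q := by ext <;> simp; omega
  right_inv p := by ext <;> simp <;> omega

variable {f : ℤ → ℝ} {C r : ℝ}

/-- The contribution to `walkGenFun f x` of the paths with `p.1` steps to the left and `p.2` steps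
to the right. -/
noncomputable def walkTerm (f : ℤ → ℝ) (x : ℝ) (p : ℕ × ℕ) : ℝ :=
  (x / 2) ^ p.1 / p.1 ! * ((x / 2) ^ p.2 / p.2 !) * f ((p.2 : ℤ) - p.1)

theorem summable_walkTerm (hr : 1 ≤ r) (hf : ∀ n, ‖f n‖ ≤ C * r ^ n.natAbs) (x : ℝ) :
    Summable (walkTerm f x) := by
  have hexp := Real.summable_pow_div_factorial (|x / 2| * r)
  have hprod := hexp.mul_of_nonneg hexp (fun _ => by positivity) (fun _ => by positivity)
  have hC : 0 ≤ C := by simpa using (norm_nonneg _).trans (hf 0)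
  refine (hprod.mul_left C).of_norm_bounded fun ⟨p, q⟩ => ?_
  calc ‖walkTerm f x (p, q)‖ = |x / 2| ^ p / p ! * (|x / 2| ^ q / q !) * ‖f ((q : ℤ) - p)‖ := by
        rw [walkTerm, norm_mul, norm_mul, norm_div, norm_div, norm_pow, norm_pow,
          Real.norm_natCast, Real.norm_natCast, Real.norm_eq_abs]
    _ ≤ |x / 2| ^ p / p ! * (|x / 2| ^ q / q !) * (C * r ^ (p + q)) := by
        gcongr
        refine (hf _).trans ?_
        gcongr
        omega
    _ = C * ((|x / 2| * r) ^ p / p ! * ((|x / 2| * r) ^ q / q !)) := by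
        rw [mul_pow, mul_pow, pow_add]
        ring

theorem sum_antidiagonal_walkTerm (f : ℤ → ℝ) (x : ℝ) (N : ℕ) :
    ∑ p ∈ antidiagonal N, walkTerm f x p = x ^ N / N ! * walkMean f N := by
  rw [walkMean, smul_eq_mul, Finset.mul_sum, Finset.mul_sum]
  refine Finset.sum_congr rfl fun p hp => ?_
  obtain rfl := mem_antidiagonal.1 hp
  rw [walkTerm, nsmul_eq_mul, Nat.cast_add_choose, div_pow, div_pow, pow_add, pow_add]
  field_simp

theorem hasSum_walkTerm (hr : 1 ≤ r) (hf : ∀ n, ‖f n‖ ≤ C * r ^ n.natAbs) (x : ℝ) :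
    HasSum (walkTerm f x) (walkGenFun f x) := by
  have hsum := (summable_walkTerm hr hf x).hasSum
  have hsigma := (Finset.HasAntidiagonal.sigmaAntidiagonalEquivProd.hasSum_iff.2 hsum).sigma
    fun N => Finset.hasSum (antidiagonal N) (walkTerm f x)
  simp only [sum_antidiagonal_walkTerm] at hsigma
  rwa [← hsigma.tsum_eq] at hsum

theorem walkTerm_differenceMinEquiv (f : ℤ → ℝ) (x : ℝ) (n : ℤ) (m : ℕ) :
    walkTerm f x (differenceMinEquiv (n, m)) =
      f n * ((x / 2) ^ (2 * m + n.natAbs) / (m ! * (m + n.natAbs)!)) := by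
  rcases n.natAbs_eq with h | h <;> generalize n.natAbs = ν at h <;> subst h
  · simp only [walkTerm, differenceMinEquiv, Equiv.coe_fn_mk, Int.toNat_neg_natCast, add_zero,
      Int.toNat_natCast, Nat.cast_add, add_sub_cancel_left]
    ring
  · simp only [walkTerm, differenceMinEquiv, Equiv.coe_fn_mk, neg_neg, Int.toNat_natCast,
      Int.toNat_neg_natCast, add_zero, Nat.cast_add, sub_add_cancel_left]
    ring

theorem hasSum_mul_besselI (hr : 1 ≤ r) (hf : ∀ n, ‖f n‖ ≤ C * r ^ n.natAbs) (x : ℝ) :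
    HasSum (fun n : ℤ => f n * besselI n.natAbs x) (walkGenFun f x) := by
  refine (differenceMinEquiv.hasSum_iff.2 (hasSum_walkTerm hr hf x)).prod_fiberwise fun n => ?_
  simp only [Function.comp_apply, walkTerm_differenceMinEquiv]
  exact (summable_besselI n.natAbs x).hasSum.mul_left (f n)

theorem hasSum_tailWeight_mul_besselI (k : ℕ) (x : ℝ) :
    HasSum (fun ν : {ν : ℕ // k + 1 ≤ ν} => ((ν.1 : ℝ) - (k + 1 : ℕ) + 2) *
      ((ν.1 : ℝ) - (k + 1 : ℕ) + 1) * besselI ν.1 x) (walkGenFun (tailWeight k) x) := by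
  have hinj : Function.Injective fun ν : {ν : ℕ // k + 1 ≤ ν} => (ν.1 : ℤ) :=
    Nat.cast_injective.comp Subtype.val_injective
  convert (hinj.hasSum_iff fun n hn => ?_).2
    (hasSum_mul_besselI one_le_two (norm_tailWeight_le k) x) using 2 with ν
  · rw [Function.comp_apply, tailWeight, if_pos (by have := ν.2; omega), Int.natAbs_natCast]
    push_cast
    ring
  · have hweight : tailWeight k n = 0 := by
      rcases lt_trichotomy (k : ℤ) n with h | rfl | h
      · exact absurd ⟨⟨n.toNat, by omega⟩, Int.toNat_of_nonneg (by omega)⟩ hn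
      · simp [tailWeight]
      · simp [tailWeight, not_le.2 h]
    rw [hweight, zero_mul]

end Bessel

section MatrixFunctions

open scoped Matrix Matrix.Norms.L2Operator MatrixOrder
open scoped Polynomial
open Polynomial (X aeval Chebyshev.T)

variable {m n : Type*} [Fintype m] [Fintype n] [DecidableEq n]

theorem norm_entry_le_l2_opNorm {𝕜 : Type*} [RCLike 𝕜] (M : Matrix m n 𝕜) (i : m) (j : n) :
    ‖M i j‖ ≤ ‖M‖ := by
  have hcol := M.l2_opNorm_mulVec (PiLp.single 2 j (1 : 𝕜))
  rw [PiLp.norm_single, norm_one, mul_one] at hcol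
  refine le_trans ?_ ((PiLp.norm_apply_le _ i).trans hcol)
  simp

theorem isHermitian_aeval {H : Matrix n n ℝ} (hH : H.IsHermitian) (p : ℝ[X]) :
    (aeval H p).IsHermitian :=
  cfc_polynomial p H hH ▸ cfc_predicate (fun x => p.eval x) H

theorem spectrum_aeval_eq_image_eval {H : Matrix n n ℝ} (hH : H.IsHermitian) (p : ℝ[X]) :
    spectrum ℝ (aeval H p) = (fun x => p.eval x) '' spectrum ℝ H :=
  cfc_polynomial p H hH ▸ cfc_map_spectrum (fun x => p.eval x) H hH

theorem norm_aeval_entry_le {H : Matrix n n ℝ} (hH : H.IsHermitian) {p : ℝ[X]} {C : ℝ} (hC : 0 ≤ C)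
    (hp : ∀ x ∈ spectrum ℝ H, ‖p.eval x‖ ≤ C) (i j : n) : ‖aeval H p i j‖ ≤ C := by
  have hsa : IsSelfAdjoint H := hH
  rw [← cfc_polynomial p H]
  exact (norm_entry_le_l2_opNorm _ i j).trans (norm_cfc_le hC hp)

theorem spectrum_conjTranspose_mul_mul_subset_Icc [DecidableEq m] {A : Matrix m m ℝ}
    (hA : A.IsHermitian) {b : ℝ} (hb : 0 ≤ b) (hspec : spectrum ℝ A ⊆ Set.Icc 0 b)
    {V : Matrix m n ℝ} (hV : Vᴴ * V ≤ 1) :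
    spectrum ℝ (Vᴴ * A * V) ⊆ Set.Icc 0 b := by
  have hsa : IsSelfAdjoint A := hA
  have hsaV : IsSelfAdjoint (Vᴴ * A * V) := Matrix.isHermitian_conjTranspose_mul_mul V hA
  have hnonneg : algebraMap ℝ _ 0 ≤ A :=
    (algebraMap_le_iff_le_spectrum hsa).2 fun x hx => (hspec hx).1
  have hle : A ≤ algebraMap ℝ _ b := (le_algebraMap_iff_spectrum_le hsa).2 fun x hx => (hspec hx).2
  rw [map_zero, Matrix.le_iff, sub_zero] at hnonneg
  rw [Matrix.le_iff] at hle hV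
  have hVnonneg : algebraMap ℝ (Matrix n n ℝ) 0 ≤ Vᴴ * A * V := by
    rw [map_zero, Matrix.le_iff, sub_zero]
    exact hnonneg.conjTranspose_mul_mul_same V
  have hVle : Vᴴ * A * V ≤ algebraMap ℝ _ b := by
    have hsplit : algebraMap ℝ _ b - Vᴴ * A * V =
        Vᴴ * (algebraMap ℝ _ b - A) * V + b • (1 - Vᴴ * V) := by
      simp only [Algebra.algebraMap_eq_smul_one, Matrix.mul_sub, Matrix.sub_mul, smul_sub,
        Matrix.mul_smul, Matrix.smul_mul, Matrix.mul_one]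
      abel
    rw [Matrix.le_iff, hsplit]
    exact (hle.conjTranspose_mul_mul_same V).add (hV.smul hb)
  exact fun x hx => ⟨(algebraMap_le_iff_le_spectrum hsaV).1 hVnonneg x hx,
    (le_algebraMap_iff_spectrum_le hsaV).1 hVle x hx⟩

theorem hasDerivAt_smul_phiMatrix {k : ℕ} (H : Matrix (Fin k) (Fin k) ℝ) (t : ℝ) :
    HasDerivAt (fun t : ℝ => t • phiMatrix (-t • H)) (NormedSpace.exp (-t • H)) t := by
  have hsummable (R : ℝ) : Summable fun N => ‖(R ^ N / N !) • (-H) ^ N‖ := by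
    convert NormedSpace.norm_expSeries_summable' (𝕂 := ℝ) (R • -H) using 3 with N
    rw [smul_pow, smul_smul, div_eq_inv_mul]
  have hphi : (fun t : ℝ => t • phiMatrix (-t • H)) =
      fun t : ℝ => ∑' N, (t ^ (N + 1) / (N + 1)!) • (-H) ^ N := by
    funext t
    rw [phiMatrix, ← tsum_const_smul'']
    refine tsum_congr fun N => ?_
    rw [neg_smul, ← smul_neg, smul_pow, smul_smul, smul_smul, pow_succ']
    congr 1
    ring
  have hexp : NormedSpace.exp (-t • H) = ∑' N, (t ^ N / N !) • (-H) ^ N := by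
    rw [NormedSpace.exp_eq_tsum ℝ]
    refine tsum_congr fun N => ?_
    rw [neg_smul, ← smul_neg, smul_pow, smul_smul, div_eq_inv_mul]
  rw [hphi, hexp]
  exact hasDerivAt_tsum_pow_succ_div_factorial_smul hsummable t

theorem mul_smul_phiMatrix_add_exp {k : ℕ} (H : Matrix (Fin k) (Fin k) ℝ) (t : ℝ) :
    H * (t • phiMatrix (-t • H)) + NormedSpace.exp (-t • H) = 1 := by
  have hexp := mul_phiMatrix (-t • H)
  rw [eq_sub_iff_add_eq] at hexp
  rw [← hexp, neg_smul, neg_mul, smul_mul_assoc, mul_smul_comm, add_neg_cancel_left]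

theorem norm_exp_smul_entry_le {M : Matrix n n ℝ} (hM : M.IsHermitian)
    (hspec : spectrum ℝ M ⊆ Set.Icc (-1) 1) {a : ℕ} {i j : n}
    (hij : ∀ p : ℝ[X], p.natDegree < a → aeval M p i j = 0) {x : ℝ} (hx : 0 ≤ x) :
    ‖NormedSpace.exp (x • M) i j‖ ≤ 2 * walkGenFun (tailIndicator a) x := by
  have hpow (N : ℕ) : ‖(M ^ N) i j‖ ≤ 2 * walkMean (tailIndicator a) N := by
    have hmoment := norm_map_X_pow_le_two_mul_walkMean
      (L := Matrix.entryLinearMap ℝ ℝ i j ∘ₗ (aeval M).toLinearMap) (a := a)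
      (fun l => norm_aeval_entry_le hM zero_le_one (fun y hy =>
        Polynomial.Chebyshev.abs_eval_T_real_le_one l (abs_le.2 (hspec hy))) i j) hij N
    simpa using hmoment
  have hsum : HasSum (fun N => x ^ N / N ! * (M ^ N) i j) (NormedSpace.exp (x • M) i j) := by
    convert Pi.hasSum.1 (Pi.hasSum.1 (NormedSpace.exp_series_hasSum_exp' (𝕂 := ℝ) (x • M)) i) j
      using 2 with N
    rw [smul_pow, smul_smul, div_eq_inv_mul]
    rfl
  rw [← hsum.tsum_eq, walkGenFun, ← tsum_mul_left]
  refine tsum_of_norm_bounded (((summable_norm_walkGenFun one_le_two (norm_tailIndicator_le a)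
    x).of_norm.mul_left 2).hasSum) fun N => ?_
  rw [norm_mul, Real.norm_of_nonneg (by positivity), mul_left_comm]
  gcongr
  exact hpow N

theorem exp_neg_smul_eq_smul_exp_smul_one_sub (H : Matrix n n ℝ) {c : ℝ} (hc : c ≠ 0) (t : ℝ) :
    NormedSpace.exp (-t • H) =
      Real.exp (-(c * t)) • NormedSpace.exp ((c * t) • (1 - c⁻¹ • H)) := by
  have hsplit : -t • H = algebraMap ℝ _ (-(c * t)) + (c * t) • (1 - c⁻¹ • H) := by
    rw [smul_sub, smul_smul, mul_right_comm, mul_inv_cancel₀ hc, one_mul,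
      Algebra.algebraMap_eq_smul_one, neg_smul, neg_smul]
    abel
  rw [hsplit, Matrix.exp_add_of_commute _ _ (Algebra.commute_algebraMap_left _ _),
    ← NormedSpace.algebraMap_exp_comm, ← Real.exp_eq_exp_ℝ, ← Algebra.smul_def]

theorem norm_exp_neg_smul_entry_le {H : Matrix n n ℝ} (hH : H.IsHermitian) {c : ℝ} (hc : 0 < c)
    (hspec : spectrum ℝ H ⊆ Set.Icc 0 (2 * c)) {a : ℕ} {i j : n}
    (hij : ∀ p : ℝ[X], p.natDegree < a → aeval H p i j = 0) {t : ℝ} (ht : 0 ≤ t) :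
    ‖NormedSpace.exp (-t • H) i j‖ ≤
      2 * (Real.exp (-(c * t)) * walkGenFun (tailIndicator a) (c * t)) := by
  let q : ℝ[X] := 1 - Polynomial.C c⁻¹ * X
  have hq : aeval H q = 1 - c⁻¹ • H := by simp [q, Algebra.smul_def]
  have hspecq : spectrum ℝ (aeval H q) ⊆ Set.Icc (-1) 1 := by
    rw [spectrum_aeval_eq_image_eval hH]
    rintro _ ⟨x, hx, rfl⟩
    have hxc : c⁻¹ * x ≤ 2 := (inv_mul_le_iff₀ hc).2 ((hspec hx).2.trans_eq (mul_comm _ _))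
    have hx0 : 0 ≤ c⁻¹ * x := mul_nonneg (inv_nonneg.2 hc.le) (hspec hx).1
    simp only [q, Polynomial.eval_sub, Polynomial.eval_one, Polynomial.eval_mul,
      Polynomial.eval_C, Polynomial.eval_X]
    constructor <;> linarith
  have hvanish (p : ℝ[X]) (hp : p.natDegree < a) : aeval (aeval H q) p i j = 0 := by
    have hdeg : q.natDegree ≤ 1 := by
      unfold q
      compute_degree
    rw [← Polynomial.aeval_comp]
    refine hij _ (lt_of_le_of_lt ?_ hp)
    rw [Polynomial.natDegree_comp]
    exact mul_le_of_le_one_right' hdeg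
  rw [exp_neg_smul_eq_smul_exp_smul_one_sub H hc.ne', ← hq, Matrix.smul_apply, norm_smul,
    Real.norm_of_nonneg (Real.exp_nonneg _), mul_left_comm]
  gcongr
  exact norm_exp_smul_entry_le (isHermitian_aeval hH q) hspecq hvanish (by positivity)

theorem mul_norm_smul_phiMatrix_entry_le {k : ℕ} {H : Matrix (Fin k) (Fin k) ℝ}
    (hH : H.IsHermitian) {c : ℝ} (hc : 0 < c) (hspec : spectrum ℝ H ⊆ Set.Icc 0 (2 * c)) {a : ℕ}
    {i j : Fin k} (hij : ∀ p : ℝ[X], p.natDegree < a → aeval H p i j = 0) {t : ℝ} (ht : 0 ≤ t) :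
    c * ‖(t • phiMatrix (-t • H)) i j‖ ≤
      2 * (Real.exp (-(c * t)) * walkGenFun (tailWeight a) (c * t)) := by
  have hderiv (s : ℝ) : HasDerivAt (fun s : ℝ => c * (s • phiMatrix (-s • H)) i j)
      (c * NormedSpace.exp (-s • H) i j) s :=
    (hasDerivAt_pi.1 (hasDerivAt_pi.1 (hasDerivAt_smul_phiMatrix H s) i) j).const_mul c
  have hmajorant (s : ℝ) : HasDerivAt
      (fun s => 2 * (Real.exp (-(c * s)) * walkGenFun (tailWeight a) (c * s)))
      (c * (2 * (Real.exp (-(c * s)) * walkGenFun (tailIndicator a) (c * s)))) s := by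
    have hcomp := ((hasDerivAt_exp_neg_mul_walkGenFun_tailWeight a (c * s)).comp s
      ((hasDerivAt_id s).const_mul c)).const_mul 2
    exact hcomp.congr_deriv (by ring)
  have hle := image_norm_le_of_norm_deriv_right_le_deriv_boundary
    (fun s _ => (hderiv s).continuousAt.continuousWithinAt)
    (fun s _ => (hderiv s).hasDerivWithinAt) (by simp [walkGenFun_zero, tailWeight_zero]) hmajorant
    (fun s hs => ?_) (Set.right_mem_Icc.2 ht)
  · rwa [norm_mul, Real.norm_of_nonneg hc.le] at hle
  · rw [norm_mul, Real.norm_of_nonneg hc.le]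
    gcongr
    exact norm_exp_neg_smul_entry_le hH hc hspec hij hs.1

end MatrixFunctions

section Normalization

variable {E : Type*} [NormedAddCommGroup E] [NormedSpace ℝ E]

theorem norm_smul_norm_inv_smul (x : E) : ‖x‖ • ‖x‖⁻¹ • x = x := by
  rcases eq_or_ne x 0 with rfl | hx
  · rw [smul_zero, smul_zero]
  · exact smul_inv_smul₀ (norm_ne_zero_iff.2 hx) x

theorem norm_norm_inv_smul_eq_one_or_eq_zero (x : E) : ‖‖x‖⁻¹ • x‖ = 1 ∨ ‖x‖⁻¹ • x = 0 := by
  rcases eq_or_ne x 0 with rfl | hx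
  · exact .inr (smul_zero _)
  · left
    rw [norm_smul, norm_inv, norm_norm, inv_mul_cancel₀ (norm_ne_zero_iff.2 hx)]

end Normalization

theorem inner_sub_sum_inner_smul_eq_zero {𝕜 E ι : Type*} [RCLike 𝕜] [NormedAddCommGroup E]
    [InnerProductSpace 𝕜 E] {s : Finset ι} {e : ι → E}
    (horth : (s : Set ι).Pairwise fun i j => inner 𝕜 (e i) (e j) = 0) {j : ι} (hj : j ∈ s)
    (hnorm : ‖e j‖ = 1 ∨ e j = 0) (x : E) :
    inner 𝕜 (e j) (x - ∑ i ∈ s, inner 𝕜 (e i) x • e i) = 0 := by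
  rw [inner_sub_right, inner_sum, Finset.sum_eq_single_of_mem j hj fun i hi hij => by
    rw [inner_smul_right, horth hj hi hij.symm, mul_zero]]
  rcases hnorm with hnorm | hzero
  · rw [inner_smul_right, inner_self_eq_norm_sq_to_K, hnorm]
    simp
  · simp [hzero]

section Arnoldi

variable {n : ℕ} (A : Matrix (Fin n) (Fin n) ℝ) (g : EuclideanSpace ℝ (Fin n))

/-- The vector `A v_j - ∑_{i ≤ j} (v_iᵀ A v_j) v_i` of the Arnoldi process, whose normalization is
the next Arnoldi vector `v_{j+1}` and whose norm is `h_{j+1,j}`; indices start from `0`. -/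
noncomputable def arnoldiRemainder (j : ℕ) : EuclideanSpace ℝ (Fin n) :=
  A.toEuclideanLin (arnoldiVec A g j) - ∑ i ∈ Finset.range (j + 1),
    inner ℝ (arnoldiVec A g i) (A.toEuclideanLin (arnoldiVec A g j)) • arnoldiVec A g i

theorem arnoldiVec_zero : arnoldiVec A g 0 = ‖g‖⁻¹ • g := by
  rw [arnoldiVec]

theorem norm_smul_arnoldiVec_zero : ‖g‖ • arnoldiVec A g 0 = g := by
  rw [arnoldiVec_zero]
  exact norm_smul_norm_inv_smul g

theorem arnoldiVec_succ (j : ℕ) :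
    arnoldiVec A g (j + 1) = ‖arnoldiRemainder A g j‖⁻¹ • arnoldiRemainder A g j := by
  rw [arnoldiVec, arnoldiRemainder, Finset.sum_range]

theorem norm_smul_arnoldiVec_succ (j : ℕ) :
    ‖arnoldiRemainder A g j‖ • arnoldiVec A g (j + 1) = arnoldiRemainder A g j := by
  rw [arnoldiVec_succ]
  exact norm_smul_norm_inv_smul _

theorem norm_arnoldiVec_eq_one_or_eq_zero (j : ℕ) :
    ‖arnoldiVec A g j‖ = 1 ∨ arnoldiVec A g j = 0 := by
  cases j with
  | zero => rw [arnoldiVec_zero]; exact norm_norm_inv_smul_eq_one_or_eq_zero g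
  | succ j => rw [arnoldiVec_succ]; exact norm_norm_inv_smul_eq_one_or_eq_zero _

theorem norm_arnoldiVec_le_one (j : ℕ) : ‖arnoldiVec A g j‖ ≤ 1 := by
  rcases norm_arnoldiVec_eq_one_or_eq_zero A g j with hnorm | hzero
  · exact hnorm.le
  · rw [hzero, norm_zero]
    exact zero_le_one

theorem pairwise_range_inner_arnoldiVec_eq_zero (k : ℕ) :
    (Finset.range k : Set ℕ).Pairwise
      fun i j => inner ℝ (arnoldiVec A g i) (arnoldiVec A g j) = 0 := by
  induction k with
  | zero => simp
  | succ k ih =>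
    suffices hnew : ∀ i ∈ Finset.range k, inner ℝ (arnoldiVec A g i) (arnoldiVec A g k) = 0 by
      rw [Finset.range_add_one, Finset.coe_insert, Set.pairwise_insert]
      exact ⟨ih, fun i hi _ => ⟨(real_inner_comm _ _).trans (hnew i hi), hnew i hi⟩⟩
    intro i hi
    obtain ⟨j, rfl⟩ : ∃ j, k = j + 1 := Nat.exists_eq_succ_of_ne_zero (by rintro rfl; simp at hi)
    rw [arnoldiVec_succ, real_inner_smul_right, arnoldiRemainder,
      inner_sub_sum_inner_smul_eq_zero ih hi (norm_arnoldiVec_eq_one_or_eq_zero A g i), mul_zero]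

theorem inner_arnoldiVec_of_ne {i j : ℕ} (hij : i ≠ j) :
    inner ℝ (arnoldiVec A g i) (arnoldiVec A g j) = 0 :=
  pairwise_range_inner_arnoldiVec_eq_zero A g (max i j + 1) (by simp) (by simp) hij

theorem toEuclideanLin_arnoldiVec (j : ℕ) :
    A.toEuclideanLin (arnoldiVec A g j) = ∑ i ∈ Finset.range (j + 1),
      inner ℝ (arnoldiVec A g i) (A.toEuclideanLin (arnoldiVec A g j)) • arnoldiVec A g i +
        ‖arnoldiRemainder A g j‖ • arnoldiVec A g (j + 1) := by
  rw [norm_smul_arnoldiVec_succ, arnoldiRemainder, add_sub_cancel]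

theorem inner_arnoldiVec_toEuclideanLin_of_lt {i j : ℕ} (hij : j < i) :
    inner ℝ (arnoldiVec A g i) (A.toEuclideanLin (arnoldiVec A g j)) =
      ‖arnoldiRemainder A g j‖ * inner ℝ (arnoldiVec A g i) (arnoldiVec A g (j + 1)) := by
  rw [toEuclideanLin_arnoldiVec, inner_add_right, inner_sum, Finset.sum_eq_zero, zero_add,
    real_inner_smul_right]
  intro l hl
  rw [real_inner_smul_right, inner_arnoldiVec_of_ne A g, mul_zero]
  exact (Finset.mem_range_succ_iff.1 hl).trans_lt hij |>.ne'

theorem inner_arnoldiVec_toEuclideanLin_of_succ_lt {i j : ℕ} (hij : j + 1 < i) :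
    inner ℝ (arnoldiVec A g i) (A.toEuclideanLin (arnoldiVec A g j)) = 0 := by
  rw [inner_arnoldiVec_toEuclideanLin_of_lt A g (by omega), inner_arnoldiVec_of_ne A g hij.ne',
    mul_zero]

theorem inner_arnoldiVec_succ_toEuclideanLin (j : ℕ) :
    inner ℝ (arnoldiVec A g (j + 1)) (A.toEuclideanLin (arnoldiVec A g j)) =
      ‖arnoldiRemainder A g j‖ := by
  rw [inner_arnoldiVec_toEuclideanLin_of_lt A g (Nat.lt_succ_self j), real_inner_self_eq_norm_sq]
  rcases norm_arnoldiVec_eq_one_or_eq_zero A g (j + 1) with hnorm | hzero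
  · rw [hnorm, one_pow, mul_one]
  · rw [← norm_smul_arnoldiVec_succ A g j, hzero]
    simp

theorem sum_range_inner_smul_arnoldiVec {j k : ℕ} (hjk : j + 1 < k) :
    ∑ i ∈ Finset.range k, inner ℝ (arnoldiVec A g i) (A.toEuclideanLin (arnoldiVec A g j)) •
      arnoldiVec A g i = A.toEuclideanLin (arnoldiVec A g j) := by
  rw [← Finset.sum_subset (Finset.range_subset_range.2 hjk), Finset.sum_range_succ _ (j + 1),
    inner_arnoldiVec_succ_toEuclideanLin]
  · exact (toEuclideanLin_arnoldiVec A g j).symm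
  · intro i _ hi
    rw [Finset.mem_range, not_lt] at hi
    rw [inner_arnoldiVec_toEuclideanLin_of_succ_lt A g hi, zero_smul]

theorem toLp_arnoldiBasis_mulVec (k : ℕ) (x : Fin k → ℝ) :
    WithLp.toLp 2 ((arnoldiBasis A g k).mulVec x) = ∑ j : Fin k, x j • arnoldiVec A g j := by
  ext i
  simp [arnoldiBasis, Matrix.mulVec, dotProduct, mul_comm]

theorem arnoldiHess_apply (k : ℕ) (i j : Fin k) :
    arnoldiHess A g k i j =
      inner ℝ (arnoldiVec A g i) (A.toEuclideanLin (arnoldiVec A g j)) := by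
  rw [arnoldiHess, Matrix.mul_assoc, Matrix.mul_apply, PiLp.inner_apply]
  refine Finset.sum_congr rfl fun l _ => ?_
  simp only [Matrix.transpose_apply, arnoldiBasis, Matrix.of_apply, Matrix.toLpLin_apply,
    Matrix.mul_apply, Matrix.mulVec, dotProduct, RCLike.inner_apply, conj_trivial]
  ring

theorem toEuclideanLin_arnoldiBasis_mulVec (k : ℕ) (x : Fin (k + 1) → ℝ) :
    A.toEuclideanLin (WithLp.toLp 2 ((arnoldiBasis A g (k + 1)).mulVec x)) =
      WithLp.toLp 2 ((arnoldiBasis A g (k + 1)).mulVec ((arnoldiHess A g (k + 1)).mulVec x)) +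
        x (Fin.last k) • arnoldiRemainder A g k := by
  have hproj : WithLp.toLp 2 ((arnoldiBasis A g (k + 1)).mulVec
      ((arnoldiHess A g (k + 1)).mulVec x)) = ∑ j : Fin (k + 1), x j • ∑ i ∈ Finset.range (k + 1),
        inner ℝ (arnoldiVec A g i) (A.toEuclideanLin (arnoldiVec A g j)) • arnoldiVec A g i := by
    simp only [toLp_arnoldiBasis_mulVec, Matrix.mulVec, dotProduct, Finset.sum_smul,
      Finset.smul_sum, Finset.sum_range, arnoldiHess_apply, smul_smul]
    rw [Finset.sum_comm]
    simp only [mul_comm]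
  rw [hproj, toLp_arnoldiBasis_mulVec, map_sum, Fin.sum_univ_castSucc, Fin.sum_univ_castSucc,
    add_assoc, ← smul_add]
  congr 1
  · refine Finset.sum_congr rfl fun j _ => ?_
    rw [map_smul, Fin.val_castSucc, sum_range_inner_smul_arnoldiVec A g (by omega)]
  · rw [map_smul, Fin.val_last, arnoldiRemainder, add_sub_cancel]

theorem arnoldiHess_pow_apply_zero_of_lt {k N : ℕ} {i : Fin (k + 1)} (hi : N < i) :
    (arnoldiHess A g (k + 1) ^ N) i 0 = 0 := by
  induction N generalizing i with
  | zero => exact Matrix.one_apply_ne (by rintro rfl; simp at hi)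
  | succ N ih =>
    rw [pow_succ', Matrix.mul_apply]
    refine Finset.sum_eq_zero fun l _ => ?_
    rcases lt_or_ge N (l : ℕ) with hl | hl
    · rw [ih hl, mul_zero]
    · rw [arnoldiHess_apply, inner_arnoldiVec_toEuclideanLin_of_succ_lt A g (by omega), zero_mul]

theorem aeval_arnoldiHess_apply_zero_of_natDegree_lt {k : ℕ} {p : Polynomial ℝ} {i : Fin (k + 1)}
    (hp : p.natDegree < i) : Polynomial.aeval (arnoldiHess A g (k + 1)) p i 0 = 0 := by
  rw [Polynomial.aeval_eq_sum_range, Matrix.sum_apply]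
  refine Finset.sum_eq_zero fun N hN => ?_
  rw [Matrix.smul_apply, arnoldiHess_pow_apply_zero_of_lt A g
    ((Finset.mem_range_succ_iff.1 hN).trans_lt hp), smul_zero]

open scoped MatrixOrder in
theorem arnoldiBasis_conjTranspose_mul_self_le_one (k : ℕ) :
    (arnoldiBasis A g k).conjTranspose * arnoldiBasis A g k ≤ 1 := by
  have hgram : (arnoldiBasis A g k).conjTranspose * arnoldiBasis A g k =
      Matrix.diagonal fun i : Fin k => ‖arnoldiVec A g i‖ ^ 2 := by
    ext i j
    have hinner : ((arnoldiBasis A g k).conjTranspose * arnoldiBasis A g k) i j =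
        inner ℝ (arnoldiVec A g i) (arnoldiVec A g j) := by
      simp [Matrix.mul_apply, arnoldiBasis, PiLp.inner_apply, mul_comm]
    rcases eq_or_ne i j with rfl | hij
    · rw [hinner, Matrix.diagonal_apply_eq, real_inner_self_eq_norm_sq]
    · rw [hinner, Matrix.diagonal_apply_ne _ hij, inner_arnoldiVec_of_ne A g (Fin.val_ne_of_ne hij)]
  rw [hgram, Matrix.le_iff, ← Matrix.diagonal_one, Matrix.diagonal_sub]
  exact Matrix.PosSemidef.diagonal fun i =>
    sub_nonneg.2 (pow_le_one₀ (norm_nonneg _) (norm_arnoldiVec_le_one A g i))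

variable {A}

theorem isHermitian_arnoldiHess (hA : A.IsHermitian) (k : ℕ) : (arnoldiHess A g k).IsHermitian :=
  Matrix.isHermitian_conjTranspose_mul_mul _ hA

theorem spectrum_arnoldiHess_subset_Icc (hA : A.IsHermitian) {b : ℝ} (hb : 0 ≤ b)
    (hspec : spectrum ℝ A ⊆ Set.Icc 0 b) (k : ℕ) : spectrum ℝ (arnoldiHess A g k) ⊆ Set.Icc 0 b :=
  spectrum_conjTranspose_mul_mul_subset_Icc hA hb hspec
    (arnoldiBasis_conjTranspose_mul_self_le_one A g k)

/-- `‖arnoldiRemainder A g k‖` is an off-diagonal entry of `H_{k+2}`, hence also one of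
`H_{k+2} - c`, whose norm is at most `c`. -/
theorem norm_arnoldiRemainder_le (hA : A.IsHermitian) {c : ℝ} (hc : 0 ≤ c)
    (hspec : spectrum ℝ A ⊆ Set.Icc 0 (2 * c)) (k : ℕ) : ‖arnoldiRemainder A g k‖ ≤ c := by
  have hentry := norm_aeval_entry_le (p := Polynomial.X - Polynomial.C c)
    (isHermitian_arnoldiHess g hA (k + 2)) hc (fun x hx => by
      obtain ⟨hx0, hxc⟩ := spectrum_arnoldiHess_subset_Icc g hA (by positivity) hspec _ hx
      rw [Polynomial.eval_sub, Polynomial.eval_X, Polynomial.eval_C, Real.norm_eq_abs, abs_le]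
      constructor <;> linarith)
    ⟨k + 1, by omega⟩ ⟨k, by omega⟩
  rwa [map_sub, Polynomial.aeval_X, Polynomial.aeval_C, Matrix.sub_apply,
    Algebra.algebraMap_eq_smul_one, Matrix.smul_apply, Matrix.one_apply_ne (by simp), smul_zero,
    sub_zero, arnoldiHess_apply, inner_arnoldiVec_succ_toEuclideanLin, norm_norm] at hentry

end Arnoldi

section Krylov

open scoped Matrix.Norms.L2Operator

variable {n : ℕ} (A : Matrix (Fin n) (Fin n) ℝ)

theorem arnoldiBasis_mulVec_single (g : EuclideanSpace ℝ (Fin n)) (k : ℕ) :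
    WithLp.toLp 2 ((arnoldiBasis A g (k + 1)).mulVec (Pi.single 0 ‖g‖)) = g := by
  rw [toLp_arnoldiBasis_mulVec, Finset.sum_eq_single_of_mem 0 (Finset.mem_univ _) fun j _ hj => by
    rw [Pi.single_eq_of_ne hj, zero_smul], Pi.single_eq_same, Fin.val_zero,
    norm_smul_arnoldiVec_zero]

theorem krylovCoeff_eq_mulVec_single (g : EuclideanSpace ℝ (Fin n)) (k : ℕ) (t : ℝ) :
    krylovCoeff A g (k + 1) t =
      (t • phiMatrix (-t • arnoldiHess A g (k + 1))).mulVec (Pi.single 0 ‖g‖) := by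
  rw [krylovCoeff, Matrix.smul_mulVec]
  congr 2
  ext i
  simp only [Pi.smul_apply, smul_eq_mul, mul_ite, mul_one, mul_zero, Pi.single_apply,
    Fin.val_eq_zero_iff]

theorem krylovCoeff_apply (g : EuclideanSpace ℝ (Fin n)) (k : ℕ) (t : ℝ) (i : Fin (k + 1)) :
    krylovCoeff A g (k + 1) t i = (t • phiMatrix (-t • arnoldiHess A g (k + 1))) i 0 * ‖g‖ := by
  rw [krylovCoeff_eq_mulVec_single, Matrix.mulVec_single]
  rfl

theorem arnoldiHess_mulVec_krylovCoeff_add (g : EuclideanSpace ℝ (Fin n)) (k : ℕ) (t : ℝ) :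
    (arnoldiHess A g (k + 1)).mulVec (krylovCoeff A g (k + 1) t) +
      (NormedSpace.exp (-t • arnoldiHess A g (k + 1))).mulVec (Pi.single 0 ‖g‖) =
        Pi.single 0 ‖g‖ := by
  rw [krylovCoeff_eq_mulVec_single, Matrix.mulVec_mulVec, ← Matrix.add_mulVec,
    mul_smul_phiMatrix_add_exp, Matrix.one_mulVec]

theorem hasDerivAt_toLp_mulVec_mulVec {m p : ℕ} (V : Matrix (Fin n) (Fin m) ℝ) (x : Fin p → ℝ)
    {M : ℝ → Matrix (Fin m) (Fin p) ℝ} {M' : Matrix (Fin m) (Fin p) ℝ} {t : ℝ}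
    (hM : HasDerivAt M M' t) :
    HasDerivAt (fun t => WithLp.toLp 2 (V.mulVec ((M t).mulVec x)))
      (WithLp.toLp 2 (V.mulVec (M'.mulVec x))) t :=
  (LinearMap.toContinuousLinearMap ((WithLp.linearEquiv 2 ℝ _).symm.toLinearMap ∘ₗ
    V.mulVecLin ∘ₗ (Matrix.mulVecBilin ℝ ℝ).flip x)).hasFDerivAt.comp_hasDerivAt t hM

variable (g v : EuclideanSpace ℝ (Fin n)) (k : ℕ)

theorem hasDerivAt_krylovApprox (t : ℝ) :
    HasDerivAt (krylovApprox A g v (k + 1))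
      (WithLp.toLp 2 ((arnoldiBasis A (g - A.toEuclideanLin v) (k + 1)).mulVec
        ((NormedSpace.exp (-t • arnoldiHess A (g - A.toEuclideanLin v) (k + 1))).mulVec
          (Pi.single 0 ‖g - A.toEuclideanLin v‖)))) t := by
  unfold krylovApprox
  simp only [krylovCoeff_eq_mulVec_single]
  exact (hasDerivAt_toLp_mulVec_mulVec _ _ (hasDerivAt_smul_phiMatrix _ t)).const_add v

theorem krylovResidual_eq_neg_smul_arnoldiRemainder (t : ℝ) :
    krylovResidual A g v (k + 1) t =
      -krylovCoeff A (g - A.toEuclideanLin v) (k + 1) t (Fin.last k) •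
        arnoldiRemainder A (g - A.toEuclideanLin v) k := by
  have hexp := eq_sub_of_add_eq' (arnoldiHess_mulVec_krylovCoeff_add A (g - A.toEuclideanLin v) k t)
  rw [krylovResidual, (hasDerivAt_krylovApprox A g v k t).deriv, krylovApprox, map_add,
    toEuclideanLin_arnoldiBasis_mulVec, hexp, Matrix.mulVec_sub, WithLp.toLp_sub,
    arnoldiBasis_mulVec_single, neg_smul]
  abel

theorem norm_krylovResidual_le (hA : A.IsHermitian) {c : ℝ} (hc : 0 < c)
    (hspec : spectrum ℝ A ⊆ Set.Icc 0 (2 * c)) {t : ℝ} (ht : 0 ≤ t) :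
    ‖krylovResidual A g v (k + 1) t‖ ≤ 2 * ‖g - A.toEuclideanLin v‖ *
      Real.exp (-(c * t)) * walkGenFun (tailWeight k) (c * t) := by
  set w := g - A.toEuclideanLin v
  have hentry := mul_norm_smul_phiMatrix_entry_le (isHermitian_arnoldiHess w hA (k + 1)) hc
    (spectrum_arnoldiHess_subset_Icc w hA (by positivity) hspec (k + 1))
    (fun p hp => aeval_arnoldiHess_apply_zero_of_natDegree_lt (i := Fin.last k) A w hp) ht
  rw [krylovResidual_eq_neg_smul_arnoldiRemainder, krylovCoeff_apply, norm_smul, norm_neg,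
    norm_mul, norm_norm]
  calc _ ≤ ‖(t • phiMatrix (-t • arnoldiHess A w (k + 1))) (Fin.last k) 0‖ * ‖w‖ * c := by
        gcongr
        exact norm_arnoldiRemainder_le w hA hc.le hspec k
    _ = ‖w‖ * (c * ‖(t • phiMatrix (-t • arnoldiHess A w (k + 1))) (Fin.last k) 0‖) := by ring
    _ ≤ ‖w‖ * (2 * (Real.exp (-(c * t)) * walkGenFun (tailWeight k) (c * t))) :=
        mul_le_mul_of_nonneg_left hentry (norm_nonneg w)
    _ = _ := by ring

theorem propositionP2_general (hA : A.IsSymm) {c : ℝ} (hc : 0 < c)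
    (hspec : spectrum ℝ A ⊆ Set.Icc 0 (2 * c)) {k : ℕ} (hk : 1 ≤ k) {t : ℝ} (ht : 0 ≤ t) :
    DifferentiableAt ℝ (krylovApprox A g v k) t ∧
    Summable (fun ν : {ν : ℕ // k ≤ ν} =>
      ((ν.1 : ℝ) - k + 2) * ((ν.1 : ℝ) - k + 1) * besselI ν.1 (c * t)) ∧
    ‖krylovResidual A g v k t‖ ≤ 2 * ‖g - A.toEuclideanLin v‖ * Real.exp (-(c * t)) *
      ∑' ν : {ν : ℕ // k ≤ ν},
        ((ν.1 : ℝ) - k + 2) * ((ν.1 : ℝ) - k + 1) * besselI ν.1 (c * t) := by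
  obtain ⟨m, rfl⟩ := Nat.exists_eq_add_of_le' hk
  have hsum := hasSum_tailWeight_mul_besselI m (c * t)
  have hherm : A.IsHermitian := (Matrix.conjTranspose_eq_transpose_of_trivial A).trans hA
  refine ⟨(hasDerivAt_krylovApprox A g v m t).differentiableAt, hsum.summable, ?_⟩
  rw [hsum.tsum_eq]
  exact norm_krylovResidual_le A g v m hherm hc hspec ht

end Krylov

theorem propositionP2 {n : ℕ} (A : Matrix (Fin n) (Fin n) ℝ) (hA : A.IsSymm)
    (c : ℝ) (hc : 0 < c) (hspec : spectrum ℝ A ⊆ Set.Icc 0 (2 * c))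
    (g v : EuclideanSpace ℝ (Fin n)) (hg : ‖g - A.toEuclideanLin v‖ = 1)
    (k : ℕ) (hk : 2 ≤ k) (t : ℝ) (ht : 0 ≤ t) :
    DifferentiableAt ℝ (krylovApprox A g v k) t ∧
    Summable (fun ν : {ν : ℕ // k ≤ ν} =>
      ((ν.1 : ℝ) - k + 2) * ((ν.1 : ℝ) - k + 1) * besselI ν.1 (c * t)) ∧
    ‖krylovResidual A g v k t‖ ≤ 4 * Real.exp (-(c * t)) *
      ∑' ν : {ν : ℕ // k ≤ ν},
        ((ν.1 : ℝ) - k + 2) * ((ν.1 : ℝ) - k + 1) * besselI ν.1 (c * t) := by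
  obtain ⟨hdiff, hsum, hbound⟩ := propositionP2_general A g v hA hc hspec (one_le_two.trans hk) ht
  exact ⟨hdiff, hsum, by rw [hg] at hbound; linarith [norm_nonneg (krylovResidual A g v k t)]⟩
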